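/- **Conventions.** A *multi-knotoid diagram* in $S^2$ is a generic immersion in $S^2$ of one oriented segment, running from its *leg* to its *head*, and finitely many oriented circles, with over/under information at each double point (crossing). A *shortcut* $\alpha$ is an oriented arc from the leg to the head, transversal to $K$ and avoiding its crossings; $c\cdot\alpha$ is the number of times an oriented curve $c$ crosses $\alpha$ from right to left minus the number of times from left to right. Order the crossings of $K$, let $n_\pm$ be the numbers of positive and negative ones, and let $\mathcal A=\mathbb Q[X]/(X^2)$ with $\deg 1=1$, $\deg X=-1$. A *state* $s$ assigns $0$ or $1$ to each crossing, that is, a $0$- or $1$-smoothing; $\|s\|$ is the number of $1$'s, and $k_s$ is the segment component of the resolved diagram, oriented from the leg to the head. The *winding complex* $C(K)$ is the direct sum over all $s$ of the tensor product of one copy of $\mathcal A$ for each closed component and one copy of $X\mathcal A$ for $k_s$. A basis element $v$ (a label $1$ or $X$ on each closed component and $X$ on $k_s$) has gradings $$i(v)=\|s\|-n_-,\qquad q(v)=\deg v+i(v)+n_+-n_-+1,\qquad \mu(v)=k_s\cdot\alpha-K\cdot\alpha .$$ The differential $d$ is the sum of the edge maps $s\to s'$ changing one $0$ to $1$, with sign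 $(-1)^{r}$, where $r$ is the number of $1$'s of $s$ before the changed place. An edge map is multiplication if two components merge, the comultiplication $1\mapsto 1\otimes X+X\otimes 1$, $X\mapsto X\otimes X$ if one component divides, and $0$ if the segment component is changed without merging or dividing. The *winding homology* is $H(K)=\bigoplus_{i,j,k}H_{i,j}^k(K)$, with $i,j,k$ the $i$-, $q$- and $u$-gradings ($\mu$), and $W_K(t,q,u)=\sum_{i,j,k}\dim_{\mathbb Q} H_{i,j}^k(K)\,t^iq^ju^k$. For an oriented link diagram $\kappa$ in $S^2$ with a base point $p$ (not a crossing), $\widetilde{Kh}_{i,j}(\kappa,p)$ is the rational reduced Khovanov homology: the homology of the subcomplex of the Khovanov complex of $\kappa$ in which the component of each state containing $p$ is labelled by $X$, with homological grading $\|s\|-n_-$ and quantum grading $\deg v+\|s\|+n_+-2n_-+1$ (so that the unknot has its generator in bidegree $(0,0)$). The multi-knotoid diagram $\kappa^\bullet$ is obtained from $\kappa$ by deleting a small arc around $p$. A multi-knotoid diagram of this form represents a *multi-knot*, and a *knot* if $\kappa$ has one component. **Theorem.** Let $\kappa$ be an oriented link diagram in $S^2$ with a base point $p$, let $K=\kappa^\bullet$,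 and let $\alpha$ be any shortcut for $K$. Then: 1. $\mu(v)=0$ for every generator $v$ of $C(K)$; in particular $H_{i,j}^k(K)=0$ for all $i,j$ and all $k\neq 0$. 2. $H_{i,j}^0(K)\cong\widetilde{Kh}_{i,j}(\kappa,p)$ as $\mathbb Q$-vector spaces, for all $i,j$. 3. Consequently the Poincaré polynomials agree: $$W_K(t,q,u)=\sum_{i,j}\dim_{\mathbb Q}\widetilde{Kh}_{i,j}(\kappa,p)\,t^iq^j .$$ -/

import Mathlib

noncomputable section

namespace WindingHomology

/-! ### Diagrams

A diagram on a closed oriented surface is recorded by its combinatorial map: the half-edges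
("darts") at its vertices, the fixed-point free involution exchanging the two halves of an edge,
the cyclic order of the darts around every vertex, the orientation, and the regions. -/

/-- The darts of a diagram, all thought of as pointing away from their vertex.

* `crossing c i`: the four darts at the crossing `c`, numbered counterclockwise starting from the
  incoming end of the underpass.  Thus `0`, `2` belong to the underpass and `1`, `3` to the overpass.
* `plain k b`: the two darts at the `k`-th auxiliary point, an interior point of an arc or circle
  where nothing happens (`b = true` is the outgoing dart).  Such points serve to put a vertex on
  every circle without crossings.
* `endpoint b`: in a multi-knotoid diagram, the only dart at the leg (`b = true`) and the only dart
  at the head (`b = false`); in a based link diagram, the outgoing (`b = true`) and the incoming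
  (`b = false`) dart at the base point. -/
inductive Dart (n m : ℕ) : Type
  | crossing (c : Fin n) (i : Fin 4)
  | plain (k : Fin m) (b : Bool)
  | endpoint (b : Bool)
  deriving DecidableEq, Fintype

variable {n m : ℕ}

/-- The next dart counterclockwise around the same vertex.  If `closed = true` the two darts
`endpoint true`, `endpoint false` sit at one bivalent vertex (the base point of a link), and if
`closed = false` they sit at two univalent vertices (the leg and the head of a multi-knotoid). -/
def Dart.next (closed : Bool) : Dart n m → Dart n m
  | .crossing c i => .crossing c (i + 1)
  | .plain k b => .plain k (!b)
  | .endpoint b => .endpoint (xor b closed)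

/-- The smoothing of all vertices in the state `s` (`s c = true` is the 1-smoothing at `c`): a dart
is sent to the dart at the same vertex to which it gets connected.  The 0-smoothing joins the two
regions swept by rotating the overpass counterclockwise, so it connects `0, 1` and `2, 3`; the
1-smoothing connects `0, 3` and `1, 2`.  An end of the segment is connected to nothing else. -/
def Dart.smooth (closed : Bool) (s : Fin n → Bool) : Dart n m → Dart n m
  | .crossing c i => .crossing c (if s c then ![3, 2, 1, 0] i else ![1, 0, 3, 2] i)
  | .plain k b => .plain k (!b)
  | .endpoint b => .endpoint (xor b closed)

/-- An oriented diagram with `n` crossings (ordered by their index) and `m` auxiliary points on a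
closed oriented surface: a based link diagram if `closed = true`, a multi-knotoid diagram (one
segment component and any number of closed components) if `closed = false`. -/
structure Diagram (closed : Bool) (n m : ℕ) where
  /-- The other half of the same edge. -/
  opp : Dart n m → Dart n m
  opp_opp : ∀ d, opp (opp d) = d
  opp_ne : ∀ d, opp d ≠ d
  /-- `out d` says that the orientation of the diagram leaves the vertex along `d`. -/
  out : Dart n m → Bool
  out_opp : ∀ d, out (opp d) = !out d
  out_under_in : ∀ c, out (.crossing c 0) = false
  out_under_out : ∀ c, out (.crossing c 2) = true
  out_over : ∀ c, out (.crossing c 3) = !out (.crossing c 1)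
  out_plain : ∀ k b, out (.plain k b) = b
  out_endpoint : ∀ b, out (.endpoint b) = b
  /-- The regions (connected components of the complement of the diagram) are the classes of this
  relation: `d` and `d'` are related if the region on the left of `d` is the region on the left of
  `d'`.  The region on the right of `d` is then the one on the left of `opp d`.  A region can have
  several boundary circuits when the diagram is not connected. -/
  region : Setoid (Dart n m)
  /-- The corner between `d` and the next dart at its vertex is on the left of `d` and on the right
  of that next dart. -/
  region_corner : ∀ d, region d (opp (d.next closed))

/-- Diagrams of oriented links with a base point. -/
abbrev BasedLinkDiagram (n m : ℕ) := Diagram true n m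

/-- Oriented multi-knotoid diagrams. -/
abbrev MultiKnotoidDiagram (n m : ℕ) := Diagram false n m

namespace Diagram

variable {closed : Bool} (D : Diagram closed n m)

/-- Darts are related if they lie in the same connected component of the diagram, viewed as a graph
(crossings are vertices). -/
def graphComponent : Setoid (Dart n m) :=
  Relation.EqvGen.setoid fun d d' => d' = D.opp d ∨ d' = d.next closed

/-- The underlying surface is the sphere: the surface is connected, and Euler's formula
`V + R = E + 1 + C` for a plane graph with `V` vertices, `E` edges, `C` connected components and `R`
regions holds. -/
def IsSpherical : Prop :=
  D.graphComponent ⊔ D.region = ⊤ ∧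
  (n + m + if closed then 1 else 2) + Nat.card (Quotient D.region) =
    (2 * n + m + 1) + 1 + Nat.card (Quotient D.graphComponent)

/-- The crossing `c` is positive: the overpass runs from `3` to `1`. -/
def IsPositive (c : Fin n) : Prop := D.out (.crossing c 1) = true

/-- The number of positive crossings. -/
def nPos : ℕ := Nat.card {c // D.IsPositive c}

/-- The number of negative crossings. -/
def nNeg : ℕ := Nat.card {c // ¬ D.IsPositive c}

/-! ### States -/

/-- Darts are related if they lie on the same component of the resolved diagram of the state `s`. -/
def stateRel (s : Fin n → Bool) : Setoid (Dart n m) :=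
  Relation.EqvGen.setoid fun d d' => d' = D.opp d ∨ d' = d.smooth closed s

/-- The components of the state `s`. -/
def Comp (s : Fin n → Bool) : Type := Quotient (D.stateRel s)

/-- The component of the state `s` that contains the dart `d`. -/
def comp (s : Fin n → Bool) (d : Dart n m) : D.Comp s := Quotient.mk (D.stateRel s) d

/-- The distinguished component of a state: the segment component of a multi-knotoid (the component
of the leg), respectively the component of a link that carries the base point. -/
def baseComp (s : Fin n → Bool) : D.Comp s := D.comp s (.endpoint true)

instance (s : Fin n → Bool) : Finite (D.Comp s) :=
  inferInstanceAs (Finite (Quotient (D.stateRel s)))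

instance (s : Fin n → Bool) : Fintype (D.Comp s) := Fintype.ofFinite _

end Diagram

/-- The basis `1, X` of `𝒜 = ℚ[X]/(X²)`. -/
inductive Label : Type
  | one
  | X
  deriving DecidableEq

instance : Finite Label :=
  Finite.of_injective (fun a : Label => decide (a = .X)) (by rintro ⟨⟩ ⟨⟩ <;> simp)

/-- `deg 1 = 1` and `deg X = -1`. -/
def Label.deg : Label → ℤ
  | .one => 1
  | .X => -1

/-- The coefficient of `c` in the product `a * b` in `𝒜`:
`1·1 = 1`, `1·X = X·1 = X`, `X·X = 0`. -/
def Label.mulCoeff : Label → Label → Label → ℚ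
  | .one, .one, .one => 1
  | .one, .X, .X => 1
  | .X, .one, .X => 1
  | _, _, _ => 0

/-- The coefficient of `b ⊗ c` in the coproduct `Δ a`:
`Δ 1 = 1 ⊗ X + X ⊗ 1`, `Δ X = X ⊗ X`. -/
def Label.comulCoeff : Label → Label → Label → ℚ
  | .one, .one, .X => 1
  | .one, .X, .one => 1
  | .X, .X, .X => 1
  | _, _, _ => 0

namespace Diagram

variable {closed : Bool} (D : Diagram closed n m)

/-- A state together with a label `1` or `X` on each of its components.  For fixed `s` these are the
pure tensors of labels, a basis of the tensor product of copies of `𝒜` indexed by the components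
of `s`. -/
structure LabelledState where
  s : Fin n → Bool
  label : D.Comp s → Label

instance : Finite D.LabelledState :=
  Finite.of_injective
    (fun v => (⟨v.s, v.label⟩ : (s : Fin n → Bool) × (D.Comp s → Label)))
    (by rintro ⟨s, l⟩ ⟨s', l'⟩ h; simpa using h)

namespace LabelledState

variable {D}

/-- The homological grading `‖s‖ - n₋`. -/
def iGrading (v : D.LabelledState) : ℤ := (Nat.card {c // v.s c = true} : ℤ) - D.nNeg

/-- The degree of a pure tensor of labels. -/
def deg (v : D.LabelledState) : ℤ := ∑ x : D.Comp v.s, (v.label x).deg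

/-- The label of the distinguished component. -/
def baseLabel (v : D.LabelledState) : Label := v.label (D.baseComp v.s)

end LabelledState

open Classical in
/-- The coefficient of `w` in the image of `v` under the (unsigned) edge map that changes the
smoothing of `c` from `0` to `1`.  Two components of `v.s` that merge are multiplied, a component
that divides is comultiplied, a component that neither merges nor divides is mapped by zero, and the
components that do not meet `c` keep their labels. -/
def edgeCoeff (c : Fin n) (v w : D.LabelledState) : ℚ :=
  let a := D.comp v.s (.crossing c 0)
  let b := D.comp v.s (.crossing c 2)
  let a' := D.comp w.s (.crossing c 0)
  let b' := D.comp w.s (.crossing c 2)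
  if ∀ d, D.comp v.s d ≠ a → D.comp v.s d ≠ b → w.label (D.comp w.s d) = v.label (D.comp v.s d) then
    if a ≠ b ∧ a' = b' then Label.mulCoeff (v.label a) (v.label b) (w.label a')
    else if a = b ∧ a' ≠ b' then Label.comulCoeff (v.label a) (w.label a') (w.label b')
    else 0
  else 0

open Classical in
/-- The coefficient of `w` in the differential of `v`: the sum over the edges of the cube from the
state of `v` to the state of `w` (there is at most one).  The sign counts the `1`s of the state
before the place that is changed; it is the sign that moves `c` in `c ∧ x` to its proper place. -/
def diffCoeff (v w : D.LabelledState) : ℚ :=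
  ∑ c : Fin n, if v.s c = false ∧ w.s = Function.update v.s c true then
    (-1) ^ Nat.card {c' // c' < c ∧ v.s c' = true} * D.edgeCoeff c v w
  else 0

end Diagram

/-- The linear endomorphism of the vector space with basis `G` whose matrix has the entry `a v w`
as the coefficient of `w` in the image of `v`. -/
def endOfCoeff {G : Type} [Finite G] (a : G → G → ℚ) : (G →₀ ℚ) →ₗ[ℚ] (G →₀ ℚ) :=
  Finsupp.linearCombination ℚ fun v => Finsupp.equivFunOnFinite.symm (a v)

/-- The homology at a graded piece `A` of a complex with differential `d`, where `B` is the graded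
piece before `A`: cycles in `A` modulo the images under `d` of elements of `B`.  (When `d ∘ d = 0` and
`d` maps `B` into `A`, all these images are cycles in `A`.) -/
abbrev HomologyAt {V : Type} [AddCommGroup V] [Module ℚ V] (d : V →ₗ[ℚ] V) (B A : Submodule ℚ V) :
    Type :=
  ↥(A ⊓ LinearMap.ker d) ⧸ (B.map d).comap (A ⊓ LinearMap.ker d).subtype

theorem finrank_homologyAt_bot {V : Type} [AddCommGroup V] [Module ℚ V] (d : V →ₗ[ℚ] V)
    (B A : Submodule ℚ V) (hA : A = ⊥) : Module.finrank ℚ (HomologyAt d B A) = 0 := by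
  subst hA
  have : Subsingleton ↥((⊥ : Submodule ℚ V) ⊓ LinearMap.ker d) := by
    rw [bot_inf_eq]; infer_instance
  exact Module.finrank_zero_of_subsingleton

/-! ### Winding homology of multi-knotoid diagrams -/

namespace Diagram

section Winding

variable (K : MultiKnotoidDiagram n m)

/-- `K.IsDualPath x l y`: starting in the region on the left of `x`, one can cross the edges of the
darts in the list `l` one after the other, each from its left to its right, and ends up in the
region on the left of `y`. -/
def IsDualPath : Dart n m → List (Dart n m) → Dart n m → Prop
  | x, [], y => K.region x y
  | x, d :: l, y => K.region x d ∧ IsDualPath (K.opp d) l y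

/-- A shortcut `α`: an oriented arc from the leg to the head that is transversal to the diagram
and avoids its crossings, recorded by the darts whose edges it crosses from left to right, in
order. -/
structure Shortcut where
  darts : List (Dart n m)
  isDualPath : K.IsDualPath (.endpoint true) darts (.endpoint false)

/-- The darts along which the segment component `k_s`, oriented from the leg to the head, leaves
their vertex. -/
inductive OnSegment (s : Fin n → Bool) : Dart n m → Prop
  | leg : OnSegment s (.endpoint true)
  | step (d : Dart n m) : OnSegment s d → K.opp d ≠ .endpoint false →
      OnSegment s ((K.opp d).smooth false s)

open Classical in
/-- The coefficient of `k_s` along the dart `d`: `1` if `k_s` traverses the edge of `d` in the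
direction of `d`, `-1` if it does so in the opposite direction, `0` if the edge is not on `k_s`. -/
def segmentCoeff (s : Fin n → Bool) (d : Dart n m) : ℤ :=
  (if K.OnSegment s d then 1 else 0) - (if K.OnSegment s (K.opp d) then 1 else 0)

/-- The coefficient of the oriented diagram `K` along the dart `d`. -/
def orientCoeff (d : Dart n m) : ℤ := if K.out d then 1 else -1

variable {K}

/-- `k_s · α`: the number of times that `k_s` crosses `α` from right to left minus the number of
times from left to right.  (When `α` crosses an edge from its left to its right, the edge crosses
`α` from right to left.) -/
def segmentDot (α : K.Shortcut) (s : Fin n → Bool) : ℤ :=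
  (α.darts.map (K.segmentCoeff s)).sum

/-- `K · α`, counted in the same way. -/
def diagramDot (α : K.Shortcut) : ℤ := (α.darts.map K.orientCoeff).sum

variable (K) in
/-- The generators of the winding complex `C(K)`: every closed component of a state is labelled by
a basis element of `𝒜`, and the segment component by the generator of `X𝒜`. -/
abbrev Generator : Type := {v : K.LabelledState // v.baseLabel = .X}

/-- The homological grading `i(v) = ‖s‖ - n₋`. -/
def iGrading (v : K.Generator) : ℤ := v.1.iGrading

/-- The grading `q(v) = deg(v) + i(v) + n₊ - n₋ + 1`. -/
def qGrading (v : K.Generator) : ℤ := v.1.deg + v.1.iGrading + K.nPos - K.nNeg + 1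

/-- The grading `μ(v) = k_s · α - K · α`. -/
def uGrading (α : K.Shortcut) (v : K.Generator) : ℤ := segmentDot α v.1.s - diagramDot α

variable (K) in
/-- The differential of the winding complex. -/
def windingD : (K.Generator →₀ ℚ) →ₗ[ℚ] (K.Generator →₀ ℚ) :=
  endOfCoeff fun v w => K.diffCoeff v.1 w.1

/-- The graded piece `C_{i,j}^k(K)`. -/
def windingC (α : K.Shortcut) (i j k : ℤ) : Submodule ℚ (K.Generator →₀ ℚ) :=
  Finsupp.supported ℚ ℚ {v | iGrading v = i ∧ qGrading v = j ∧ uGrading α v = k}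

/-- The winding homology `H_{i,j}^k(K)`. -/
abbrev WindingH (α : K.Shortcut) (i j k : ℤ) : Type :=
  HomologyAt K.windingD (windingC α (i - 1) j k) (windingC α i j k)

/-- The Poincaré polynomial `W_K(t,q,u)`, the sum of `dim H_{i,j}^k(K) t^i q^j u^k` over all integers
`i, j, k`, as a Laurent polynomial: the exponent `(i, j, k)` stands for `t^i q^j u^k`. -/
def windingPoincare (α : K.Shortcut) : AddMonoidAlgebra ℤ (ℤ × ℤ × ℤ) :=
  .ofCoeff <| Finsupp.onFinset
    (Set.finite_range fun v : K.Generator => (iGrading v, qGrading v, uGrading α v)).toFinset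
    (fun e => (Module.finrank ℚ (WindingH α e.1 e.2.1 e.2.2) : ℤ)) (by
      rintro ⟨i, j, k⟩ h
      by_contra hn
      refine h ?_
      norm_cast
      refine finrank_homologyAt_bot _ _ _ ?_
      have : {v : K.Generator | iGrading v = i ∧ qGrading v = j ∧ uGrading α v = k} = ∅ := by
        ext v
        simp only [Set.Finite.mem_toFinset, Set.mem_range, not_exists, Prod.mk.injEq] at hn
        simpa using hn v
      rw [windingC, this, Finsupp.supported_empty])

end Winding

/-! ### Reduced Khovanov homology of based link diagrams -/

section Khovanov

variable (L : BasedLinkDiagram n m)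

/-- The differential of the (unreduced) Khovanov complex, in which every component of a state is
labelled by a basis element of `𝒜`. -/
def khovanovD : (L.LabelledState →₀ ℚ) →ₗ[ℚ] (L.LabelledState →₀ ℚ) := endOfCoeff L.diffCoeff

/-- The quantum grading `deg(v) + i(v) + n₊ - n₋` of the Khovanov complex. -/
def khovanovQ {L : BasedLinkDiagram n m} (v : L.LabelledState) : ℤ :=
  v.deg + v.iGrading + L.nPos - L.nNeg

/-- The piece of bidegree `(i, j)` of the reduced Khovanov complex: the subcomplex of the Khovanov
complex in which the component with the base point is labelled by `X`, with the quantum grading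
raised by one, so that the unknot has its generator in bidegree `(0, 0)`. -/
def reducedC (i j : ℤ) : Submodule ℚ (L.LabelledState →₀ ℚ) :=
  Finsupp.supported ℚ ℚ {v | v.baseLabel = .X ∧ v.iGrading = i ∧ khovanovQ v + 1 = j}

/-- The reduced Khovanov homology in bidegree `(i, j)`. -/
abbrev ReducedKh (i j : ℤ) : Type :=
  HomologyAt L.khovanovD (L.reducedC (i - 1) j) (L.reducedC i j)

/-- The Poincaré polynomial of the reduced Khovanov homology, the sum of
`dim Kh_{i,j}(L) t^i q^j` over all integers `i, j`, as a Laurent polynomial in `t, q`. -/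
def reducedPoincare : AddMonoidAlgebra ℤ (ℤ × ℤ) :=
  .ofCoeff <| Finsupp.onFinset
    (Set.finite_range fun v : L.LabelledState => (v.iGrading, khovanovQ v + 1)).toFinset
    (fun e => (Module.finrank ℚ (L.ReducedKh e.1 e.2) : ℤ)) (by
      rintro ⟨i, j⟩ h
      by_contra hn
      refine h ?_
      norm_cast
      refine finrank_homologyAt_bot _ _ _ ?_
      have : {v : L.LabelledState | v.baseLabel = .X ∧ v.iGrading = i ∧ khovanovQ v + 1 = j} = ∅ := by
        ext v
        simp only [Set.Finite.mem_toFinset, Set.mem_range, not_exists, Prod.mk.injEq] at hn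
        simpa using fun _ => hn v
      rw [reducedC, this, Finsupp.supported_empty])

/-- The (multi-)knotoid diagram `κ^•` obtained from a link diagram with a base point by deleting a
small arc around the base point.  The component of the base point becomes the segment component,
which leaves the leg along `endpoint true` and arrives at the head along `endpoint false`; the two
regions adjacent to the deleted arc become one. -/
def cut : MultiKnotoidDiagram n m where
  opp := L.opp
  opp_opp := L.opp_opp
  opp_ne := L.opp_ne
  out := L.out
  out_opp := L.out_opp
  out_under_in := L.out_under_in
  out_under_out := L.out_under_out
  out_over := L.out_over
  out_plain := L.out_plain
  out_endpoint := L.out_endpoint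
  region := L.region ⊔
    Relation.EqvGen.setoid fun d d' => d = .endpoint true ∧ d' = .endpoint false
  region_corner := by
    intro d
    have hle : ∀ {x y}, L.region x y → (L.region ⊔ Relation.EqvGen.setoid fun d d' =>
        d = Dart.endpoint true ∧ d' = Dart.endpoint false) x y := fun h =>
      (le_sup_left : L.region ≤ _) h
    cases d with
    | crossing c i => exact hle (L.region_corner (.crossing c i))
    | plain k b => exact hle (L.region_corner (.plain k b))
    | endpoint b =>
      have h : (L.region ⊔ Relation.EqvGen.setoid fun d d' =>
          d = Dart.endpoint true ∧ d' = Dart.endpoint false)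
          (.endpoint true) (.endpoint false) :=
        (le_sup_right : _ ≤ L.region ⊔ _) (Relation.EqvGen.rel _ _ ⟨rfl, rfl⟩)
      have h1 := hle (L.region_corner (.endpoint true))
      have h0 := hle (L.region_corner (.endpoint false))
      simp only [Dart.next, Bool.xor_true, Bool.not_true, Bool.not_false, Bool.xor_false]
        at h1 h0 ⊢
      cases b
      · exact Setoid.trans' _ (Setoid.symm' _ h) h1
      · exact Setoid.trans' _ h h0

end Khovanov

end Diagram

end WindingHomology

end

noncomputable section

namespace WindingHomology

variable {n m : ℕ}

/-! The segment `k_s` and the diagram both run from leg to head, so their difference closes up at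
the base point and is a 1-cycle on the graph of `κ`. Since `H₁(S²) = 0`, this cycle is the jump
across edges of a potential `f` on the regions of `κ` (`IsFlow.exists_coboundary`). Both curves
leave the leg along the same edge, so the cycle vanishes there; hence `f` agrees on the two sides of
the deleted arc and is well defined on the regions of `κ^•`. Along any shortcut the jumps telescope
to the difference of `f` between the regions at leg and head, which coincide for `κ^•`. So `k_s · α
= K · α` in every state (`segmentDot_eq_diagramDot`).

Once the `u`-grading is trivial, the two complexes coincide. The segment of each state really ends
at the head, so deleting the arc does not change the partition of the darts into components
(`stateRel_cut`). The states, labels and edge maps of `κ^•` are therefore those of `κ`, and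
labelling the segment by `X` singles out the reduced subcomplex. -/

theorem Dart.smooth_smooth (closed : Bool) (s : Fin n → Bool) (d : Dart n m) :
    (d.smooth closed s).smooth closed s = d := by
  cases d with
  | crossing c i =>
    simp only [Dart.smooth]
    split_ifs <;> fin_cases i <;> rfl
  | plain k b => simp [Dart.smooth]
  | endpoint b => cases b <;> cases closed <;> rfl

theorem Dart.smooth_ne_self {s : Fin n → Bool} {d : Dart n m} (hd : ∀ b, d ≠ .endpoint b) :
    d.smooth false s ≠ d := by
  cases d with
  | crossing c i =>
    simp only [Dart.smooth]
    split_ifs <;> fin_cases i <;> simp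
  | plain k b => simp [Dart.smooth]
  | endpoint b => exact absurd rfl (hd b)

theorem Dart.smooth_ne_endpoint {s : Fin n → Bool} {d : Dart n m} (hd : ∀ b, d ≠ .endpoint b)
    (b : Bool) : d.smooth false s ≠ .endpoint b := by
  cases d with
  | crossing c i => simp [Dart.smooth]
  | plain k b => simp [Dart.smooth]
  | endpoint b => exact absurd rfl (hd b)

/-- A sum over all darts, arranged by vertices. -/
theorem Dart.sum_eq {M : Type*} [AddCommMonoid M] (f : Dart n m → M) :
    ∑ d, f d = (∑ c, ∑ i, f (.crossing c i)) + (∑ k, (f (.plain k true) + f (.plain k false))) +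
      (f (.endpoint true) + f (.endpoint false)) := by
  let e : (Fin n × Fin 4) ⊕ (Fin m × Bool) ⊕ Bool ≃ Dart n m :=
    { toFun := Sum.elim (fun p => .crossing p.1 p.2)
        (Sum.elim (fun p => .plain p.1 p.2) fun b => .endpoint b)
      invFun := fun
        | .crossing c i => .inl (c, i)
        | .plain k b => .inr (.inl (k, b))
        | .endpoint b => .inr (.inr b)
      left_inv := by rintro (⟨c, i⟩ | ⟨k, b⟩ | b) <;> rfl
      right_inv := by rintro (⟨c, i⟩ | ⟨k, b⟩ | b) <;> rfl }
  rw [← e.sum_comp]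
  simp [e, Fintype.sum_sum_type, Fintype.sum_prod_type, add_assoc]

theorem Dart.card_eq : Fintype.card (Dart n m) = 4 * n + 2 * m + 2 := by
  have := Dart.sum_eq (n := n) (m := m) fun _ => 1
  simp at this
  omega

namespace Diagram

/-! ### The segment component of a state as an oriented path from leg to head. -/

section Segment

variable (K : MultiKnotoidDiagram n m) {s : Fin n → Bool}

/-- The smoothing is an involution, so away from the endpoints a step of the walk can be undone: the
segment leaves along `d` exactly if it has arrived along the dart smoothed to `d`. -/
theorem onSegment_opp_smooth {d : Dart n m} (hd : ∀ b, d ≠ .endpoint b) :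
    K.OnSegment s (K.opp (d.smooth false s)) ↔ K.OnSegment s d := by
  constructor
  · intro h
    have := OnSegment.step _ h (by rw [K.opp_opp]; exact Dart.smooth_ne_endpoint hd false)
    rwa [K.opp_opp, Dart.smooth_smooth] at this
  · intro h
    cases h with
    | leg => exact absurd rfl (hd true)
    | step d' h' _ => rwa [Dart.smooth_smooth, K.opp_opp]

/-- The smoothing fixes the head, so a step producing it would have to start from an edge arriving
at the head, where the walk stops. -/
theorem not_onSegment_head : ¬ K.OnSegment s (.endpoint false) := by
  intro h
  generalize hd : (Dart.endpoint false : Dart n m) = d at h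
  cases h with
  | leg => simp at hd
  | step d' h' hne =>
    apply hne
    rw [← Dart.smooth_smooth false s (K.opp d'), ← hd]
    rfl

/-- The segment component does not come back to the leg: otherwise the darts of the edges that it
traverses in both directions would be paired by `opp`, and all of them but the leg by the
smoothing. -/
theorem not_onSegment_opp_leg : ¬ K.OnSegment s (K.opp (.endpoint true)) := by
  classical
  intro h
  let I : Finset (Dart n m) := {d | K.OnSegment s d ∧ K.OnSegment s (K.opp d)}
  have hleg : (.endpoint true : Dart n m) ∈ I := by simp [I, h, OnSegment.leg]
  have h1 : ∑ d ∈ I, (1 : ZMod 2) = 0 := by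
    refine Finset.sum_involution (fun d _ => K.opp d) (fun _ _ => by decide)
      (fun d _ _ => K.opp_ne d) (fun d hd => ?_) (fun d _ => K.opp_opp d)
    simp only [I, Finset.mem_filter_univ, K.opp_opp] at hd ⊢
    exact hd.symm
  have hend : ∀ d ∈ I.erase (.endpoint true), ∀ b, d ≠ .endpoint b := by
    rintro d hd b rfl
    cases b
    · simp [I, not_onSegment_head] at hd
    · simp at hd
  have h2 : ∑ d ∈ I.erase (.endpoint true), (1 : ZMod 2) = 0 := by
    refine Finset.sum_involution (fun d _ => d.smooth false s) (fun _ _ => by decide)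
      (fun d hd _ => Dart.smooth_ne_self (hend d hd)) (fun d hd => ?_)
      (fun d _ => Dart.smooth_smooth false s d)
    have hd' := hend d hd
    simp only [I, Finset.mem_erase, Finset.mem_filter_univ] at hd ⊢
    refine ⟨Dart.smooth_ne_endpoint hd' true, ?_, (K.onSegment_opp_smooth hd').2 hd.2.1⟩
    have := OnSegment.step _ hd.2.2 (by rw [K.opp_opp]; exact hd' false)
    rwa [K.opp_opp] at this
  rw [← Finset.add_sum_erase _ _ hleg, h2] at h1
  exact absurd h1 (by decide)

theorem segmentCoeff_opp (d : Dart n m) :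
    K.segmentCoeff s (K.opp d) = -K.segmentCoeff s d := by
  unfold segmentCoeff
  rw [neg_sub]
  congr 2
  rw [K.opp_opp]

/-- Conservation at interior vertices: each passage enters along one dart of a smoothing pair and
leaves along the other. -/
theorem segmentCoeff_smooth {d : Dart n m} (hd : ∀ b, d ≠ .endpoint b) :
    K.segmentCoeff s (d.smooth false s) = -K.segmentCoeff s d := by
  have h := K.onSegment_opp_smooth (s := s) hd
  have h' := K.onSegment_opp_smooth (s := s) (Dart.smooth_ne_endpoint (s := s) hd)
  rw [Dart.smooth_smooth] at h'
  unfold segmentCoeff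
  rw [neg_sub, ← h']
  congr 2
  exact propext h

theorem sum_segmentCoeff_crossing (c : Fin n) :
    ∑ i, K.segmentCoeff s (.crossing c i) = 0 := by
  have h i := K.segmentCoeff_smooth (s := s) (d := .crossing c i) (by simp)
  have h0 := h 0
  have h1 := h 1
  have h2 := h 2
  cases hs : s c <;> simp [Dart.smooth, hs] at h0 h1 h2 <;> simp [Fin.sum_univ_four] <;> omega

theorem segmentCoeff_plain (k : Fin m) (b : Bool) :
    K.segmentCoeff s (.plain k (!b)) = -K.segmentCoeff s (.plain k b) :=
  K.segmentCoeff_smooth (s := s) (d := .plain k b) (by simp)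

theorem segmentCoeff_leg : K.segmentCoeff s (.endpoint true) = 1 := by
  simp [segmentCoeff, OnSegment.leg, not_onSegment_opp_leg]

/-- The coefficients sum to zero over all darts, by antisymmetry under `opp`, and over each interior
vertex, by conservation. What leaves the leg must therefore arrive at the head; no termination
argument for the walk is needed. -/
theorem segmentCoeff_head : K.segmentCoeff s (.endpoint false) = -1 := by
  have h : ∑ d, K.segmentCoeff s d = 0 := by
    have h1 : ∑ d, K.segmentCoeff s (K.opp d) = ∑ d, K.segmentCoeff s d :=
      Equiv.sum_comp (Function.Involutive.toPerm K.opp K.opp_opp) (K.segmentCoeff s)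
    simp only [segmentCoeff_opp, Finset.sum_neg_distrib] at h1
    omega
  have hp (k : Fin m) : K.segmentCoeff s (.plain k false) = -K.segmentCoeff s (.plain k true) :=
    K.segmentCoeff_plain k true
  rw [Dart.sum_eq] at h
  simp only [sum_segmentCoeff_crossing, hp, add_neg_cancel, Finset.sum_const_zero,
    segmentCoeff_leg] at h
  omega

theorem onSegment_opp_head : K.OnSegment s (K.opp (.endpoint false)) := by
  by_contra h
  simpa [segmentCoeff, not_onSegment_head, h] using K.segmentCoeff_head (s := s)

theorem stateRel_opp {closed : Bool} (D : Diagram closed n m) (s : Fin n → Bool) (d : Dart n m) :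
    D.stateRel s d (D.opp d) :=
  .rel _ _ (.inl rfl)

theorem stateRel_smooth {closed : Bool} (D : Diagram closed n m) (s : Fin n → Bool)
    (d : Dart n m) : D.stateRel s d (d.smooth closed s) :=
  .rel _ _ (.inr rfl)

variable {K} in
theorem OnSegment.stateRel {d : Dart n m} (h : K.OnSegment s d) :
    K.stateRel s (.endpoint true) d := by
  induction h with
  | leg => exact Setoid.refl' _ _
  | step d _ _ ih =>
    exact Setoid.trans' _ (Setoid.trans' _ ih (K.stateRel_opp s d)) (K.stateRel_smooth s _)

/-- This recovers the one generating relation that is lost when the arc at the base point is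
deleted. -/
theorem stateRel_leg_head : K.stateRel s (.endpoint true) (.endpoint false) :=
  Setoid.trans' _ K.onSegment_opp_head.stateRel (Setoid.symm' _ (K.stateRel_opp s _))

end Segment

/-- The state relation of `κ^•` is that of `κ`. -/
theorem stateRel_cut (κ : BasedLinkDiagram n m) (s : Fin n → Bool) :
    κ.cut.stateRel s = κ.stateRel s := by
  apply le_antisymm
  · refine Setoid.eqvGen_le ?_
    rintro d d' (rfl | rfl)
    · exact κ.stateRel_opp s d
    · cases d with
      | crossing c i => exact κ.stateRel_smooth s _
      | plain k b => exact κ.stateRel_smooth s _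
      | endpoint b => simp [Dart.smooth]
  · refine Setoid.eqvGen_le ?_
    rintro d d' (rfl | rfl)
    · exact κ.cut.stateRel_opp s d
    · cases d with
      | crossing c i => exact κ.cut.stateRel_smooth s _
      | plain k b => exact κ.cut.stateRel_smooth s _
      -- In `κ` the smoothing joins the two endpoint darts; in `κ^•` they are joined through the
      -- whole segment.
      | endpoint b =>
        cases b
        · exact Setoid.symm' _ κ.cut.stateRel_leg_head
        · exact κ.cut.stateRel_leg_head

end Diagram

/-! ### Flows and coboundaries on the sphere. -/

/-- The vertex of a dart of a based link diagram. -/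
def Dart.vertex : Dart n m → Fin n ⊕ Fin m ⊕ Unit
  | .crossing c _ => .inl c
  | .plain k _ => .inr (.inl k)
  | .endpoint _ => .inr (.inr ())

/-- Composition with `π`, as a linear map into the Euclidean space of functions on `ι`. -/
def pullback {ι X : Type} (π : ι → X) : (X → ℝ) →ₗ[ℝ] EuclideanSpace ℝ ι :=
  (WithLp.linearEquiv 2 ℝ (ι → ℝ)).symm.toLinearMap ∘ₗ LinearMap.funLeft ℝ ℝ π

@[simp]
theorem pullback_apply {ι X : Type} (π : ι → X) (f : X → ℝ) (i : ι) :
    pullback π f i = f (π i) := rfl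

theorem finrank_range_pullback {ι X : Type} [Finite X] {π : ι → X}
    (hπ : Function.Surjective π) : Module.finrank ℝ (pullback π).range = Nat.card X := by
  cases nonempty_fintype X
  rw [LinearMap.finrank_range_of_inj, Module.finrank_fintype_fun_eq_card, Nat.card_eq_fintype_card]
  exact (WithLp.linearEquiv 2 ℝ (ι → ℝ)).symm.injective.comp
    (LinearMap.funLeft_injective_of_surjective ℝ ℝ π hπ)

namespace Diagram

variable {closed : Bool}

/-- The outgoing dart of the edge of `d`. -/
def outDart (D : Diagram closed n m) (d : Dart n m) : {d // D.out d = true} :=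
  if h : D.out d = true then ⟨d, h⟩ else ⟨D.opp d, by simpa [D.out_opp] using h⟩

theorem outDart_opp (D : Diagram closed n m) (d : Dart n m) :
    D.outDart (D.opp d) = D.outDart d := by
  by_cases h : D.out d = true <;> simp [outDart, D.out_opp, D.opp_opp, h]

theorem outDart_surjective (D : Diagram closed n m) : Function.Surjective D.outDart :=
  fun d => ⟨d.1, by simp [outDart, d.2]⟩

/-- This counts the edges: two darts go out at each crossing, one at each auxiliary point, and one
of the two endpoint darts does. -/
theorem card_out (D : Diagram closed n m) : Nat.card {d // D.out d = true} = 2 * n + m + 1 := by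
  have h := Dart.sum_eq fun d => if D.out d = true then 1 else 0
  have hc (c : Fin n) : (∑ i, if D.out (.crossing c i) = true then 1 else 0) = 2 := by
    rw [Fin.sum_univ_four, D.out_under_in, D.out_under_out, D.out_over]
    cases D.out (.crossing c 1) <;> simp
  simp only [hc, D.out_plain, D.out_endpoint, Finset.sum_boole] at h
  rw [Nat.card_eq_fintype_card, Fintype.card_subtype]
  simp at h
  omega

/-- A function on the darts is a flow if it is antisymmetric and its sum at every vertex is zero,
where the two endpoints are thought of as one vertex. -/
structure IsFlow (D : Diagram closed n m) (z : Dart n m → ℝ) : Prop where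
  opp : ∀ d, z (D.opp d) = -z d
  crossing : ∀ c, ∑ i, z (.crossing c i) = 0
  plain : ∀ k, z (.plain k true) + z (.plain k false) = 0
  endpoint : z (.endpoint true) + z (.endpoint false) = 0

/-- The vertex equations say that `z` is orthogonal to functions of the vertex; antisymmetry makes
it orthogonal to functions of the edge. -/
theorem IsFlow.mem_orthogonal {D : Diagram closed n m} {z : Dart n m → ℝ} (hz : D.IsFlow z) :
    WithLp.toLp 2 z ∈ ((pullback Dart.vertex).range ⊔ (pullback D.outDart).range)ᗮ := by
  rw [← Submodule.inf_orthogonal, Submodule.mem_inf]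
  simp only [Submodule.mem_orthogonal, LinearMap.mem_range]
  constructor
  · rintro _ ⟨f, rfl⟩
    simp only [PiLp.inner_apply, pullback_apply, RCLike.inner_apply, conj_trivial]
    rw [Dart.sum_eq]
    simp only [Dart.vertex, ← Finset.sum_mul, ← add_mul, hz.crossing, hz.plain, hz.endpoint]
    simp
  · rintro _ ⟨f, rfl⟩
    simp only [PiLp.inner_apply, pullback_apply, RCLike.inner_apply, conj_trivial]
    have h : ∑ d, z (D.opp d) * f (D.outDart (D.opp d)) = ∑ d, z d * f (D.outDart d) :=
      Equiv.sum_comp (Function.Involutive.toPerm D.opp D.opp_opp) fun d => z d * f (D.outDart d)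
    simp only [hz.opp, outDart_opp, neg_mul, Finset.sum_neg_distrib] at h
    linarith

/-- The flow whose value on `d` is the difference of the values of a function of the regions to the
left and to the right of `d`. -/
def coboundary (D : Diagram closed n m) :
    (Quotient D.region → ℝ) →ₗ[ℝ] EuclideanSpace ℝ (Dart n m) :=
  pullback (Quotient.mk D.region) - pullback fun d => Quotient.mk D.region (D.opp d)

theorem coboundary_apply (D : Diagram closed n m) (f : Quotient D.region → ℝ) (d : Dart n m) :
    D.coboundary f d = f (Quotient.mk _ d) - f (Quotient.mk _ (D.opp d)) := rfl

/-- The region to the right of the next dart is the one to the left of the present dart, so the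
differences cancel cyclically around each vertex, the base point included. -/
theorem isFlow_coboundary (κ : BasedLinkDiagram n m) (f : Quotient κ.region → ℝ) :
    κ.IsFlow (κ.coboundary f) := by
  have h (d) : Quotient.mk κ.region (κ.opp (d.next true)) = Quotient.mk κ.region d :=
    (Quotient.sound (κ.region_corner d)).symm
  refine ⟨fun d => ?_, fun c => ?_, fun k => ?_, ?_⟩
  · simp only [coboundary_apply, κ.opp_opp]
    ring
  · have h0 := h (.crossing c 0)
    have h1 := h (.crossing c 1)
    have h2 := h (.crossing c 2)
    have h3 := h (.crossing c 3)
    simp only [Dart.next, zero_add, Fin.reduceAdd] at h0 h1 h2 h3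
    simp only [Fin.sum_univ_four, coboundary_apply, h0, h1, h2, h3]
    ring
  · have h0 := h (.plain k true)
    have h1 := h (.plain k false)
    simp only [Dart.next, Bool.not_true, Bool.not_false] at h0 h1
    simp only [coboundary_apply, h0, h1]
    ring
  · have h0 := h (.endpoint true)
    have h1 := h (.endpoint false)
    simp only [Dart.next, Bool.xor_true, Bool.not_true, Bool.not_false] at h0 h1
    simp only [coboundary_apply, h0, h1]
    ring

/-- A function of the regions without jumps is constant along graph components as well as on
regions, hence constant because the surface is connected. -/
theorem finrank_ker_coboundary_le {κ : BasedLinkDiagram n m} (hκ : κ.IsSpherical) :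
    Module.finrank ℝ κ.coboundary.ker ≤ 1 := by
  refine finrank_le_one ⟨1, by ext d; simp [coboundary_apply]⟩ fun ⟨f, hf⟩ => ?_
  have hf' (d) : f (Quotient.mk _ d) = f (Quotient.mk _ (κ.opp d)) := by
    rw [← sub_eq_zero, ← coboundary_apply, LinearMap.mem_ker.1 hf]
    rfl
  have hle : κ.graphComponent ⊔ κ.region ≤ Setoid.ker fun d => f (Quotient.mk _ d) := by
    refine sup_le (Setoid.eqvGen_le ?_) fun d d' h => congrArg f (Quotient.sound h)
    rintro d d' (rfl | rfl)
    · exact hf' d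
    · exact (congrArg f (Quotient.sound (κ.region_corner d))).trans (hf' _).symm
  rw [hκ.1] at hle
  refine ⟨f (Quotient.mk _ (.endpoint true)), Subtype.ext (funext fun x => ?_)⟩
  induction x using Quotient.inductionOn with
  | h d => simpa using hle (x := .endpoint true) (y := d) trivial

/-- On the sphere, every flow is a coboundary. -/
theorem IsFlow.exists_coboundary {κ : BasedLinkDiagram n m} (hκ : κ.IsSpherical)
    {z : Dart n m → ℝ} (hz : κ.IsFlow z) : ∃ f, κ.coboundary f = WithLp.toLp 2 z := by
  set V := (pullback (Dart.vertex (n := n) (m := m))).range with hV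
  set S := (pullback κ.outDart).range with hS
  have hVdim : Module.finrank ℝ V = n + m + 1 := by
    rw [hV, finrank_range_pullback]
    · simp [add_assoc]
    · rintro (c | k | _)
      exacts [⟨.crossing c 0, rfl⟩, ⟨.plain k true, rfl⟩, ⟨.endpoint true, rfl⟩]
  have hSdim : Module.finrank ℝ S = 2 * n + m + 1 := by
    rw [hS, finrank_range_pullback κ.outDart_surjective, card_out]
  -- A function of the darts that depends only on the vertex and only on the edge is constant on
  -- graph components.
  have hinf : Module.finrank ℝ ↥(V ⊓ S) ≤ Nat.card (Quotient κ.graphComponent) := by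
    rw [← finrank_range_pullback (Quotient.mk_surjective (s := κ.graphComponent))]
    refine Submodule.finrank_mono ?_
    rintro g ⟨⟨a, ha⟩, ⟨b, hb⟩⟩
    have hle : κ.graphComponent ≤ Setoid.ker fun d => g d := by
      refine Setoid.eqvGen_le ?_
      rintro d d' (rfl | rfl)
      · simp only [Setoid.ker_def, ← hb, pullback_apply, outDart_opp]
      · simp only [Setoid.ker_def, ← ha, pullback_apply]
        cases d <;> rfl
    exact ⟨Quotient.lift (fun d => g d) fun _ _ h => hle h, rfl⟩
  have hsup := Submodule.finrank_sup_add_finrank_inf_eq V S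
  have horth := Submodule.finrank_add_finrank_orthogonal (V ⊔ S)
  rw [finrank_euclideanSpace, Dart.card_eq] at horth
  have hrange := κ.coboundary.finrank_range_add_finrank_ker
  cases nonempty_fintype (Quotient κ.region)
  rw [Module.finrank_fintype_fun_eq_card, ← Nat.card_eq_fintype_card] at hrange
  have hker := finrank_ker_coboundary_le hκ
  have heuler := hκ.2
  simp only [if_true] at heuler
  have hle : κ.coboundary.range ≤ (V ⊔ S)ᗮ := by
    rintro _ ⟨f, rfl⟩
    exact (isFlow_coboundary κ f).mem_orthogonal
  -- With `C` graph components and `R` regions, the orthogonal complement has dimension at most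
  -- `(4n+2m+2) - (n+m+1) - (2n+m+1) + C = n + C`. The coboundaries have dimension at least `R - 1`,
  -- which is `n + C` by Euler's formula.
  have heq := Submodule.eq_of_le_of_finrank_le hle (by omega)
  exact LinearMap.mem_range.1 (heq ▸ hz.mem_orthogonal)

/-! ### Vanishing of the `u`-grading. -/

theorem isFlow_segmentCoeff_sub_orientCoeff (κ : BasedLinkDiagram n m) (s : Fin n → Bool) :
    κ.IsFlow fun d => ((κ.cut.segmentCoeff s d - κ.cut.orientCoeff d : ℤ) : ℝ) := by
  refine ⟨fun d => ?_, fun c => ?_, fun k => ?_, ?_⟩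
  · have h1 : κ.cut.segmentCoeff s (κ.opp d) = _ := κ.cut.segmentCoeff_opp d
    have h2 : κ.cut.orientCoeff (κ.opp d) = -κ.cut.orientCoeff d := by
      have := κ.cut.out_opp d
      change κ.cut.out (κ.opp d) = _ at this
      unfold orientCoeff
      rw [this]
      cases κ.cut.out d <;> simp
    rw [h1, h2]
    push_cast
    ring
  · norm_cast
    rw [Finset.sum_sub_distrib, sum_segmentCoeff_crossing, Fin.sum_univ_four]
    simp only [orientCoeff, κ.cut.out_under_in, κ.cut.out_under_out, κ.cut.out_over]
    cases κ.cut.out (.crossing c 1) <;> simp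
  · norm_cast
    have := κ.cut.segmentCoeff_plain (s := s) k true
    simp only [Bool.not_true] at this
    rw [this]
    simp [orientCoeff, κ.cut.out_plain]
  · simp [orientCoeff, κ.cut.out_endpoint, segmentCoeff_leg, segmentCoeff_head]

/-- Each crossed edge contributes the drop of the potential `f` from its left to its right, and `f`
is constant between crossings, so the sum telescopes. -/
theorem IsDualPath.sum_eq {K : MultiKnotoidDiagram n m} {f z : Dart n m → ℝ}
    (hf : K.region ≤ Setoid.ker f) (hz : ∀ d, z d = f d - f (K.opp d)) {l : List (Dart n m)}
    {x y : Dart n m} (h : K.IsDualPath x l y) : (l.map z).sum = f x - f y := by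
  induction l generalizing x with
  | nil => simpa using (sub_eq_zero.2 (hf h)).symm
  | cons d l ih =>
    rw [List.map_cons, List.sum_cons, ih h.2, hz, show f x = f d from hf h.1]
    ring

theorem segmentDot_eq_diagramDot {κ : BasedLinkDiagram n m} (hκ : κ.IsSpherical)
    (α : κ.cut.Shortcut) (s : Fin n → Bool) : segmentDot α s = diagramDot α := by
  obtain ⟨f, hf⟩ := (κ.isFlow_segmentCoeff_sub_orientCoeff s).exists_coboundary hκ
  have hz (d : Dart n m) : ((κ.cut.segmentCoeff s d - κ.cut.orientCoeff d : ℤ) : ℝ) =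
      f (Quotient.mk _ d) - f (Quotient.mk _ (κ.opp d)) := by
    rw [← coboundary_apply, hf]
  -- The segment and the diagram both have coefficient `1` at the leg, so `f` does not jump across
  -- that edge. Its right side is the left side of `endpoint false`, by the corner at the base
  -- point.
  have hends : f (Quotient.mk _ (.endpoint true)) = f (Quotient.mk _ (.endpoint false)) := by
    have h := hz (.endpoint true)
    have hc : Quotient.mk κ.region (.endpoint false) =
        Quotient.mk κ.region (κ.opp (.endpoint true)) :=
      Quotient.sound (κ.region_corner (.endpoint false))
    rw [segmentCoeff_leg, ← hc] at h
    simp only [orientCoeff, κ.cut.out_endpoint, if_true, sub_self, Int.cast_zero] at h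
    linarith
  have hregion : κ.cut.region ≤ Setoid.ker fun d => f (Quotient.mk κ.region d) := by
    refine sup_le (fun d d' h => congrArg f (Quotient.sound h)) (Setoid.eqvGen_le ?_)
    rintro _ _ ⟨rfl, rfl⟩
    exact hends
  have h := α.isDualPath.sum_eq hregion hz
  rw [hends, sub_self] at h
  have h' : ((segmentDot α s - diagramDot α : ℤ) : ℝ) =
      (α.darts.map fun d => ((κ.cut.segmentCoeff s d - κ.cut.orientCoeff d : ℤ) : ℝ)).sum := by
    unfold segmentDot diagramDot
    induction α.darts with
    | nil => simp
    | cons d l ih =>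
      simp only [List.map_cons, List.sum_cons]
      rw [← ih]
      push_cast
      ring
  rw [h] at h'
  exact sub_eq_zero.1 (by exact_mod_cast h')

end Diagram

/-! ### Homology under injective chain maps. -/

theorem endOfCoeff_single {G : Type} [Finite G] (a : G → G → ℚ) (v w : G) :
    endOfCoeff a (Finsupp.single v 1) w = a v w := by
  simp [endOfCoeff]

/-- Injective chain maps identify the homology of graded pieces with that of their images. -/
def HomologyAt.mapEquiv {V W : Type} [AddCommGroup V] [Module ℚ V] [AddCommGroup W] [Module ℚ W]
    {d : V →ₗ[ℚ] V} {d' : W →ₗ[ℚ] W} (f : V →ₗ[ℚ] W) (hf : Function.Injective f)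
    (hd : f ∘ₗ d = d' ∘ₗ f) {B A : Submodule ℚ V} {B' A' : Submodule ℚ W} (hB : B.map f = B')
    (hA : A.map f = A') : HomologyAt d B A ≃ₗ[ℚ] HomologyAt d' B' A' := by
  have hcycle : (A ⊓ LinearMap.ker d).map f = A' ⊓ LinearMap.ker d' := by
    have hker : LinearMap.ker d = (LinearMap.ker d').comap f := by
      rw [← LinearMap.ker_comp, ← hd, LinearMap.ker_comp_of_ker_eq_bot d (LinearMap.ker_eq_bot.2 hf)]
    -- Since `f` is injective, cycles are detected after applying `f`, so the image of the cycles of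
    -- `A` is exactly the set of cycles of `A'`.
    rw [hker, ← hA]
    exact SetLike.coe_injective (Set.image_inter_preimage f A (LinearMap.ker d'))
  let e := (Submodule.equivMapOfInjective f hf (A ⊓ LinearMap.ker d)).trans
    (LinearEquiv.ofEq _ _ hcycle)
  have he (x) : (e x : W) = f x := rfl
  refine Submodule.Quotient.equiv _ _ e ?_
  have hB' : B'.map d' = (B.map d).map f := by
    rw [← hB, ← Submodule.map_comp, ← Submodule.map_comp, hd]
  ext y
  obtain ⟨x, rfl⟩ := e.surjective y
  rw [Submodule.mem_map_equiv, e.symm_apply_apply, Submodule.mem_comap, Submodule.mem_comap,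
    Submodule.subtype_apply, Submodule.subtype_apply, he, hB', Submodule.mem_map]
  exact ⟨fun h => ⟨x, h, rfl⟩, fun ⟨_, h, hx⟩ => hf hx ▸ h⟩

namespace Diagram

/-! ### The subcomplex with distinguished label `X`. -/

section Subcomplex

variable {closed : Bool} (D : Diagram closed n m) {s : Fin n → Bool} {c : Fin n}

theorem comp_opp (d : Dart n m) : D.comp s (D.opp d) = D.comp s d :=
  Quotient.sound (Setoid.symm' _ (D.stateRel_opp s d))

theorem comp_smooth (d : Dart n m) : D.comp s (d.smooth closed s) = D.comp s d :=
  Quotient.sound (Setoid.symm' _ (D.stateRel_smooth s d))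

/-- The 1-smoothing pairs `0` with `3` and `1` with `2`, so the darts `0` and `2` represent both
strands at `c`. -/
theorem comp_crossing_of_true (hs : s c = true) (i : Fin 4) :
    D.comp s (.crossing c i) = D.comp s (.crossing c 0) ∨
      D.comp s (.crossing c i) = D.comp s (.crossing c 2) := by
  have h0 := D.comp_smooth (s := s) (.crossing c 0)
  have h2 := D.comp_smooth (s := s) (.crossing c 2)
  simp only [Dart.smooth, hs, if_true] at h0 h2
  fin_cases i
  exacts [.inl rfl, .inr h2, .inr rfl, .inl h0]

/-- A dart on a component that meets the crossing `c` is on such a component after the smoothing of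
`c` has been changed. -/
theorem comp_update {d : Dart n m} {i : Fin 4} (h : D.comp s d = D.comp s (.crossing c i)) :
    D.comp (Function.update s c true) d = D.comp (Function.update s c true) (.crossing c 0) ∨
      D.comp (Function.update s c true) d =
        D.comp (Function.update s c true) (.crossing c 2) := by
  set s' := Function.update s c true with hs'
  have hc : s' c = true := by simp [hs']
  -- Meeting `c` in the new state is a property invariant under the generators of the old state
  -- relation: away from `c` the smoothings agree, and at `c` all four darts have it.
  have hle : D.stateRel s ≤ Setoid.ker fun d =>
      D.comp s' d = D.comp s' (.crossing c 0) ∨ D.comp s' d = D.comp s' (.crossing c 2) := by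
    refine Setoid.eqvGen_le ?_
    rintro d d' (rfl | rfl)
    · simp only [Setoid.ker_def, comp_opp]
    · simp only [Setoid.ker_def]
      cases d with
      | crossing c' j =>
        by_cases hcc : c' = c
        · subst hcc
          simp only [Dart.smooth, D.comp_crossing_of_true hc]
        · rw [← D.comp_smooth (s := s') (.crossing c' j)]
          simp [Dart.smooth, hs', hcc]
      | plain k b => rw [← D.comp_smooth (s := s') (.plain k b)]; rfl
      | endpoint b => rw [← D.comp_smooth (s := s') (.endpoint b)]; rfl
  exact (iff_of_eq (hle (Quotient.exact h))).2 (D.comp_crossing_of_true hc i)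

/-- `X𝒜` is an ideal and `ΔX = X ⊗ X`, so a component labelled `X` passes this label on to whatever
it merges or divides into. -/
theorem baseLabel_of_edgeCoeff_ne_zero {v w : D.LabelledState}
    (hw : w.s = Function.update v.s c true) (h : D.edgeCoeff c v w ≠ 0)
    (hv : v.baseLabel = .X) : w.baseLabel = .X := by
  obtain ⟨s, lv⟩ := v
  obtain ⟨s', lw⟩ := w
  simp only at hw
  subst hw
  simp only [LabelledState.baseLabel, baseComp] at hv ⊢
  simp only [edgeCoeff] at h
  split_ifs at h with hlabel hmerge hdivide
  · by_cases hb : D.comp s (.endpoint true) = D.comp s (.crossing c 0) ∨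
      D.comp s (.endpoint true) = D.comp s (.crossing c 2)
    · have hb' : D.comp (Function.update s c true) (.endpoint true) =
          D.comp (Function.update s c true) (.crossing c 0) := by
        -- After a merger the two alternatives of `comp_update` are the same component.
        rcases hb with hb | hb <;> rcases D.comp_update hb with h' | h'
        all_goals first | exact h' | exact h'.trans hmerge.2.symm
      rw [hb']
      rcases hb with hb | hb <;> rw [hb] at hv <;> rw [hv] at h <;> revert h
      · cases lv (D.comp s (.crossing c 2)) <;>
          cases lw (D.comp (Function.update s c true) (.crossing c 0)) <;> simp [Label.mulCoeff]
      · cases lv (D.comp s (.crossing c 0)) <;>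
          cases lw (D.comp (Function.update s c true) (.crossing c 0)) <;> simp [Label.mulCoeff]
    · rw [not_or] at hb
      rw [hlabel _ hb.1 hb.2, hv]
  · by_cases hb : D.comp s (.endpoint true) = D.comp s (.crossing c 0)
    · rw [← hb, hv] at h
      rcases D.comp_update hb with h' | h' <;> rw [h'] <;> revert h <;>
        cases lw (D.comp (Function.update s c true) (.crossing c 0)) <;>
        cases lw (D.comp (Function.update s c true) (.crossing c 2)) <;> simp [Label.comulCoeff]
    · rw [hlabel _ hb (hdivide.1 ▸ hb), hv]
  · exact absurd rfl h
  · exact absurd rfl h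

/-- The labelled states whose distinguished component is labelled by `X` span a subcomplex. -/
theorem baseLabel_of_diffCoeff_ne_zero {v w : D.LabelledState} (h : D.diffCoeff v w ≠ 0)
    (hv : v.baseLabel = .X) : w.baseLabel = .X := by
  obtain ⟨c, -, hc⟩ := Finset.exists_ne_zero_of_sum_ne_zero h
  split_ifs at hc with hs
  · exact D.baseLabel_of_edgeCoeff_ne_zero hs.2 (right_ne_zero_of_mul hc) hv
  · exact absurd rfl hc

end Subcomplex

/-! ### Comparison of the complexes of `κ^•` and `κ`. -/

/-- An edge map depends on the components of the two states only through the partitions of the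
darts. -/
theorem edgeCoeff_congr {closed closed' : Bool} {D : Diagram closed n m}
    {D' : Diagram closed' n m} (c : Fin n) {v w : D.LabelledState} {v' w' : D'.LabelledState}
    (hv : ∀ d d', D.comp v.s d = D.comp v.s d' ↔ D'.comp v'.s d = D'.comp v'.s d')
    (hw : ∀ d d', D.comp w.s d = D.comp w.s d' ↔ D'.comp w'.s d = D'.comp w'.s d')
    (hlv : ∀ d, v.label (D.comp v.s d) = v'.label (D'.comp v'.s d))
    (hlw : ∀ d, w.label (D.comp w.s d) = w'.label (D'.comp w'.s d)) :
    D.edgeCoeff c v w = D'.edgeCoeff c v' w' := by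
  have hcond : (∀ d, D.comp v.s d ≠ D.comp v.s (.crossing c 0) →
      D.comp v.s d ≠ D.comp v.s (.crossing c 2) →
        w.label (D.comp w.s d) = v.label (D.comp v.s d)) ↔
      ∀ d, D'.comp v'.s d ≠ D'.comp v'.s (.crossing c 0) →
        D'.comp v'.s d ≠ D'.comp v'.s (.crossing c 2) →
          w'.label (D'.comp w'.s d) = v'.label (D'.comp v'.s d) := by
    simp only [ne_eq, hv, hlv, hlw]
  unfold edgeCoeff
  classical
  refine if_congr hcond (if_congr ((hv _ _).not.and (hw _ _)) ?_
    (if_congr ((hv _ _).and (hw _ _).not) ?_ rfl)) rfl <;> simp only [hlv, hlw]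

section Cut

variable (κ : BasedLinkDiagram n m)

/-- The components of a state of `κ^•` are those of the same state of `κ`. -/
def compCutEquiv (s : Fin n → Bool) : κ.cut.Comp s ≃ κ.Comp s :=
  Quotient.congr (.refl _) fun d d' => by rw [κ.stateRel_cut]; rfl

/-- The labelled states of `κ^•` are those of `κ`. -/
def labelledStateCutEquiv : κ.cut.LabelledState ≃ κ.LabelledState where
  toFun v := ⟨v.s, v.label ∘ (κ.compCutEquiv v.s).symm⟩
  invFun v := ⟨v.s, v.label ∘ κ.compCutEquiv v.s⟩
  left_inv v := by simp [Function.comp_assoc]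
  right_inv v := by simp [Function.comp_assoc]

theorem labelledStateCutEquiv_label_comp (v : κ.cut.LabelledState) (d : Dart n m) :
    (κ.labelledStateCutEquiv v).label (κ.comp (κ.labelledStateCutEquiv v).s d) =
      v.label (κ.cut.comp v.s d) := rfl

theorem comp_labelledStateCutEquiv_eq_iff (v : κ.cut.LabelledState) {d d' : Dart n m} :
    κ.comp (κ.labelledStateCutEquiv v).s d = κ.comp (κ.labelledStateCutEquiv v).s d' ↔
      κ.cut.comp v.s d = κ.cut.comp v.s d' :=
  (κ.compCutEquiv v.s).apply_eq_iff_eq (x := κ.cut.comp v.s d) (y := κ.cut.comp v.s d')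

theorem labelledStateCutEquiv_deg (v : κ.cut.LabelledState) :
    (κ.labelledStateCutEquiv v).deg = v.deg :=
  Equiv.sum_comp (κ.compCutEquiv v.s).symm fun x => (v.label x).deg

theorem edgeCoeff_labelledStateCutEquiv (c : Fin n) (v w : κ.cut.LabelledState) :
    κ.edgeCoeff c (κ.labelledStateCutEquiv v) (κ.labelledStateCutEquiv w) =
      κ.cut.edgeCoeff c v w :=
  edgeCoeff_congr c (fun _ _ => κ.comp_labelledStateCutEquiv_eq_iff v)
    (fun _ _ => κ.comp_labelledStateCutEquiv_eq_iff w) (κ.labelledStateCutEquiv_label_comp v)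
    (κ.labelledStateCutEquiv_label_comp w)

theorem diffCoeff_labelledStateCutEquiv (v w : κ.cut.LabelledState) :
    κ.diffCoeff (κ.labelledStateCutEquiv v) (κ.labelledStateCutEquiv w) =
      κ.cut.diffCoeff v w := by
  simp only [diffCoeff, edgeCoeff_labelledStateCutEquiv]
  rfl

/-- The generators of the winding complex of `κ^•` as labelled states of `κ`. -/
def generatorToLabelledState (v : κ.cut.Generator) : κ.LabelledState :=
  κ.labelledStateCutEquiv v.1

theorem generatorToLabelledState_injective : Function.Injective κ.generatorToLabelledState :=
  κ.labelledStateCutEquiv.injective.comp Subtype.val_injective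

theorem range_generatorToLabelledState :
    Set.range κ.generatorToLabelledState = {v | v.baseLabel = .X} := by
  ext v
  constructor
  · rintro ⟨w, rfl⟩
    exact w.2
  · intro hv
    exact ⟨⟨κ.labelledStateCutEquiv.symm v, hv⟩, κ.labelledStateCutEquiv.apply_symm_apply v⟩

/-- The inclusion of the winding complex of `κ^•` into the Khovanov complex of `κ`. -/
def windingToKhovanov : (κ.cut.Generator →₀ ℚ) →ₗ[ℚ] (κ.LabelledState →₀ ℚ) :=
  Finsupp.lmapDomain ℚ ℚ κ.generatorToLabelledState

theorem windingToKhovanov_comp_windingD :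
    κ.windingToKhovanov ∘ₗ κ.cut.windingD = κ.khovanovD ∘ₗ κ.windingToKhovanov := by
  refine Finsupp.lhom_ext' fun v => LinearMap.ext_ring (Finsupp.ext fun w => ?_)
  simp only [LinearMap.comp_apply, Finsupp.lsingle_apply, windingToKhovanov,
    Finsupp.lmapDomain_apply, Finsupp.mapDomain_single, khovanovD, windingD, endOfCoeff_single]
  by_cases hw : w ∈ Set.range κ.generatorToLabelledState
  · obtain ⟨w, rfl⟩ := hw
    rw [Finsupp.mapDomain_apply κ.generatorToLabelledState_injective, endOfCoeff_single]
    exact (κ.diffCoeff_labelledStateCutEquiv v.1 w.1).symm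
  -- Outside the range the distinguished label is not `X`, and the subcomplex property makes the
  -- Khovanov coefficient zero too.
  · rw [Finsupp.mapDomain_of_notMem_range _ _ hw]
    by_contra hne
    rw [range_generatorToLabelledState] at hw
    exact hw (κ.baseLabel_of_diffCoeff_ne_zero (Ne.symm hne) v.2)

theorem khovanovQ_generatorToLabelledState (v : κ.cut.Generator) :
    khovanovQ (κ.generatorToLabelledState v) + 1 = qGrading v := by
  have h := κ.labelledStateCutEquiv_deg v.1
  unfold khovanovQ qGrading generatorToLabelledState
  rw [h]
  rfl

variable {κ}

theorem uGrading_cut (hκ : κ.IsSpherical) (α : κ.cut.Shortcut) (v : κ.cut.Generator) :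
    uGrading α v = 0 :=
  sub_eq_zero.2 (segmentDot_eq_diagramDot hκ α v.1.s)

/-- The condition on the `u`-grading is vacuous for `k = 0`, and the other two gradings are
preserved; so the graded piece is carried onto the whole reduced piece. -/
theorem map_windingC (hκ : κ.IsSpherical) (α : κ.cut.Shortcut) (i j : ℤ) :
    (windingC α i j 0).map κ.windingToKhovanov = κ.reducedC i j := by
  rw [windingC, windingToKhovanov, Finsupp.lmapDomain_supported, reducedC]
  congr 1
  ext w
  simp only [uGrading_cut hκ, and_true, Set.mem_image, Set.mem_ofPred_eq]
  constructor
  · rintro ⟨v, ⟨rfl, rfl⟩, rfl⟩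
    exact ⟨v.2, rfl, κ.khovanovQ_generatorToLabelledState v⟩
  · rintro ⟨hw, rfl, rfl⟩
    obtain ⟨v, rfl⟩ := κ.range_generatorToLabelledState.symm.subset hw
    exact ⟨v, ⟨rfl, (κ.khovanovQ_generatorToLabelledState v).symm⟩, rfl⟩

/-- The winding homology of `κ^•` in `u`-grading zero is the reduced Khovanov homology of `κ`. -/
def windingHEquivReducedKh (hκ : κ.IsSpherical) (α : κ.cut.Shortcut) (i j : ℤ) :
    WindingH α i j 0 ≃ₗ[ℚ] κ.ReducedKh i j :=
  HomologyAt.mapEquiv κ.windingToKhovanov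
    (Finsupp.mapDomain_injective κ.generatorToLabelledState_injective)
    κ.windingToKhovanov_comp_windingD (map_windingC hκ α (i - 1) j) (map_windingC hκ α i j)

theorem subsingleton_windingH (hκ : κ.IsSpherical) (α : κ.cut.Shortcut) (i j : ℤ) {k : ℤ}
    (hk : k ≠ 0) : Subsingleton (WindingH α i j k) := by
  have h : windingC α i j k = ⊥ := by
    simp only [windingC, uGrading_cut hκ, hk.symm, and_false, Set.ofPred_false,
      Finsupp.supported_empty]
  have : Subsingleton ↥(windingC α i j k ⊓ LinearMap.ker κ.cut.windingD) := by
    rw [h, bot_inf_eq]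
    infer_instance
  exact Quotient.instSubsingletonQuotient _

theorem windingPoincare_cut (hκ : κ.IsSpherical) (α : κ.cut.Shortcut) :
    windingPoincare α =
      AddMonoidAlgebra.mapDomain (fun e : ℤ × ℤ => (e.1, e.2, (0 : ℤ))) κ.reducedPoincare := by
  refine AddMonoidAlgebra.coeff_injective (Finsupp.ext ?_)
  rintro ⟨i, j, k⟩
  change (Module.finrank ℚ (WindingH α i j k) : ℤ) =
    Finsupp.mapDomain (fun e : ℤ × ℤ => (e.1, e.2, (0 : ℤ))) κ.reducedPoincare.coeff (i, j, k)
  by_cases hk : k = 0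
  · subst hk
    have hinj : Function.Injective fun e : ℤ × ℤ => (e.1, e.2, (0 : ℤ)) := by
      rintro ⟨a, b⟩ ⟨a', b'⟩ h
      simpa using h
    refine Eq.trans ?_ (Finsupp.mapDomain_apply hinj κ.reducedPoincare.coeff (i, j)).symm
    exact congrArg Nat.cast (windingHEquivReducedKh hκ α i j).finrank_eq
  · have := subsingleton_windingH hκ α i j hk
    rw [Module.finrank_zero_of_subsingleton, Finsupp.mapDomain_of_notMem_range]
    · rfl
    · rintro ⟨e, he⟩
      simp only [Prod.mk.injEq] at he
      exact hk he.2.2.symm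

end Cut

end Diagram

end WindingHomology

end

open WindingHomology Diagram in
theorem theorem3p2 {n m : ℕ} (κ : BasedLinkDiagram n m) (hκ : κ.IsSpherical)
    (α : κ.cut.Shortcut) :
    (∀ v : κ.cut.Generator, uGrading α v = 0) ∧
    (∀ i j : ℤ, Nonempty (WindingH α i j 0 ≃ₗ[ℚ] κ.ReducedKh i j)) ∧
    (∀ i j k : ℤ, k ≠ 0 → Subsingleton (WindingH α i j k)) ∧
    windingPoincare α =
      AddMonoidAlgebra.mapDomain (fun e : ℤ × ℤ => (e.1, e.2, (0 : ℤ))) κ.reducedPoincare :=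
  ⟨uGrading_cut hκ α, fun i j => ⟨windingHEquivReducedKh hκ α i j⟩,
    fun i j _ hk => subsingleton_windingH hκ α i j hk, windingPoincare_cut hκ α⟩
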